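/- Let $\mathbb{D}$ be the open unit disc of $\mathbb{C}$, $\mathbb{T}$ its boundary, $dA=\frac1\pi\,dx\,dy$, and fix $\zeta>\frac12$. For $\eta\in\mathbb{T}$ let $\Gamma(\eta)=\{z\in\mathbb{D}:|z-\eta|<\zeta(1-|z|^2)\}$. For $re^{i\theta}\in\mathbb{D}\setminus\{0\}$ let $S(re^{i\theta})=\{\lambda e^{it}\in\mathbb{D}:|t-\theta|\le\frac{1-r}{2},\ 1-\lambda\le 1-r\}$, and let $S(0)=\mathbb{D}$. For $1\le p<\infty$ and $\alpha>-2$, the analytic tent space $AT_p^\infty(\alpha)$ consists of all analytic functions $f$ on $\mathbb{D}$ with $$\|f\|_{AT_p^\infty(\alpha)}^p=\operatorname*{ess\,sup}_{\eta\in\mathbb{T}}\ \sup_{u\in\Gamma(\eta)}\frac{1}{1-|u|^2}\int_{S(u)}|f(z)|^p(1-|z|^2)^{\alpha+1}\,dA(z)<\infty .$$ Theorem. Let $1\le p<\infty$, $\alpha>-2$, and let $\mu$ be a finite positive Borel measure on $[0,1)$. The Cesàro-like operator $$\mathcal{C}_\mu f(z)=\int_{[0,1)}\frac{f(tz)}{1-tz}\,d\mu(t),\qquad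 z\in\mathbb{D},$$ is bounded on $AT_p^\infty(\alpha)$ (that is, it maps $AT_p^\infty(\alpha)$ into itself and there is a constant $C$ with $\|\mathcal{C}_\mu f\|_{AT_p^\infty(\alpha)}\le C\|f\|_{AT_p^\infty(\alpha)}$ for all $f\in AT_p^\infty(\alpha)$) if and only if $\mu$ is a Carleson measure on $[0,1)$, i.e. there is a constant $C>0$ such that $\mu([t,1))\le C(1-t)$ for all $0\le t<1$. -/

import Mathlib

open MeasureTheory
open scoped ENNReal NNReal

noncomputable section

/-- The open unit disc `𝔻` of the complex plane. Functions on `𝔻` are represented by functions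
`ℂ → ℂ`; everything below depends only on their values on `𝔻`. -/
def unitDisc : Set ℂ := Metric.ball 0 1

/-- The normalized area measure `dA = π⁻¹ dx dy`. -/
def areaMeasure : Measure ℂ := ENNReal.ofReal (1 / Real.pi) • volume

/-- The non-tangential approach region `Γ_ζ(η) = {z ∈ 𝔻 : |z - η| < ζ (1 - |z|²)}`. -/
def approachRegion (ζ : ℝ) (η : ℂ) : Set ℂ :=
  {z | z ∈ unitDisc ∧ ‖z - η‖ < ζ * (1 - ‖z‖ ^ 2)}

open Classical in
/-- The Carleson box
`S(r e^{iθ}) = {l e^{it} ∈ 𝔻 : |t - θ| ≤ (1 - r) / 2, 1 - l ≤ 1 - r}` for `0 < r < 1`,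
and `S(0) = 𝔻`. Since `t` ranges over all real numbers, the choice of the argument `θ` of the
point does not matter. -/
def carlesonBox (u : ℂ) : Set ℂ :=
  if u = 0 then unitDisc
  else {z | ∃ l t : ℝ, z = (l : ℂ) * Complex.exp ((t : ℂ) * Complex.I) ∧
    |t - Complex.arg u| ≤ (1 - ‖u‖) / 2 ∧ 1 - l ≤ 1 - ‖u‖ ∧ l < 1}

/-- The average
`(1 - |u|²)⁻¹ ∫_{S(u)} |f(z)|^p (1 - |z|²)^(α + 1) dA(z)`, with values in `[0, ∞]`. -/
def boxAverage (p α : ℝ) (f : ℂ → ℂ) (u : ℂ) : ℝ≥0∞ :=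
  ENNReal.ofReal (1 / (1 - ‖u‖ ^ 2)) *
    ∫⁻ z in carlesonBox u, ENNReal.ofReal (‖f z‖ ^ p * (1 - ‖z‖ ^ 2) ^ (α + 1)) ∂areaMeasure

/-- The tent space norm `‖f‖_{T_p^∞(α)}`, with values in `[0, ∞]`: the `p`-th root of
`esssup_{η ∈ 𝕋} sup_{u ∈ Γ_ζ(η)} (1 - |u|²)⁻¹ ∫_{S(u)} |f(z)|^p (1 - |z|²)^(α + 1) dA(z)`.
The unit circle `𝕋` is parametrized by `η = e^{iθ}`, `0 < θ ≤ 2π`. -/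
def tentNorm (ζ p α : ℝ) (f : ℂ → ℂ) : ℝ≥0∞ :=
  (essSup (fun θ : ℝ =>
      ⨆ u ∈ approachRegion ζ (Complex.exp ((θ : ℂ) * Complex.I)), boxAverage p α f u)
    (volume.restrict (Set.Ioc 0 (2 * Real.pi)))) ^ (1 / p)

/-- The tent space `T_p^∞(α)`: measurable functions on `𝔻` with finite tent norm. -/
def tentSpace (ζ p α : ℝ) : Set (ℂ → ℂ) :=
  {f | AEMeasurable f (areaMeasure.restrict unitDisc) ∧ tentNorm ζ p α f < ∞}

/-- The analytic (Hardy-Carleson type) tent space `AT_p^∞(α) = T_p^∞(α) ∩ H(𝔻)`. -/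
def analyticTentSpace (ζ p α : ℝ) : Set (ℂ → ℂ) :=
  tentSpace ζ p α ∩ {f | DifferentiableOn ℂ f unitDisc}

/-- The Cesàro-like operator `C_μ f (z) = ∫_{[0,1)} f(tz) / (1 - tz) dμ(t)`. -/
def cesaroLike (μ : Measure (Set.Ico (0 : ℝ) 1)) (f : ℂ → ℂ) (z : ℂ) : ℂ :=
  ∫ t : Set.Ico (0 : ℝ) 1, f (((t : ℝ) : ℂ) * z) / (1 - ((t : ℝ) : ℂ) * z) ∂μ

/-- An operator `T` is bounded on `AT_p^∞(α)`: it maps the space into itself and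
`‖T f‖ ≤ C ‖f‖` with a constant `C` independent of `f`. -/
def IsBoundedOnAnalyticTentSpace (ζ p α : ℝ) (T : (ℂ → ℂ) → (ℂ → ℂ)) : Prop :=
  ∃ C : ℝ≥0, ∀ f ∈ analyticTentSpace ζ p α,
    T f ∈ analyticTentSpace ζ p α ∧ tentNorm ζ p α (T f) ≤ (C : ℝ≥0∞) * tentNorm ζ p α f

/-- `μ` is a Carleson measure on `[0,1)`: `μ([t,1)) ≤ C (1 - t)` for all `0 ≤ t < 1`. -/
def IsCarlesonMeasure (μ : Measure (Set.Ico (0 : ℝ) 1)) : Prop :=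
  ∃ C : ℝ, 0 < C ∧ ∀ t : Set.Ico (0 : ℝ) 1, μ (Set.Ici t) ≤ ENNReal.ofReal (C * (1 - (t : ℝ)))

end

/-! Put γ = (α+2)/p. Both directions rest on pointwise estimates.

Subharmonicity of |f|^p gives the growth |f(z)| ≲ ‖f‖ (1-|z|)^(-γ)
(`exists_norm_le_of_mem_analyticTentSpace`). Growth alone does not imply membership, but the
stronger bound (1-|z|)^(a-γ) |1-z|^(-a) does when a > 0 and ap < 1: over a box of side h, the
integrand (1-|z|)^(ap-1) |1-z|^(-ap) separates in polar coordinates and contributes h^(ap) ·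
h^(1-ap) = h (`exists_boxAverage_le_of_norm_le`).

Sufficiency: for a Carleson measure and 0 < a < γ, a ≤ 1, integrating the growth bound against
1/|1-tz| produces exactly this stronger bound for C_μ f
(`IsCarlesonMeasure.exists_norm_cesaroLike_le`), so any 0 < a < min(γ, 1/p) works.

Necessity: one test function suffices. (1-z)^(-γ) obeys the stronger bound, so its image lies in the
space. At x in [0,1) the image is at least a multiple of μ([x,1)) (1-x)^(-γ-1), and the growth
estimate bounds it by a multiple of (1-x)^(-γ). -/

/-! ### Area mean values and subharmonicity of |f|^p. -/

theorem integral_ball_eq_of_differentiableOn {f : ℂ → ℂ} {c : ℂ} {R ρ : ℝ}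
    (hf : DifferentiableOn ℂ f (Metric.ball c R)) (hρ : 0 < ρ) (hρR : ρ < R) :
    ∫ z in Metric.ball c ρ, f z = ((Real.pi * ρ ^ 2 : ℝ) : ℂ) * f c := by
  have hcont : ContinuousOn f (Metric.ball c R) := hf.continuousOn
  have h1 : ∫ z in Metric.ball c ρ, f z
      = ∫ z : ℂ, (Metric.ball (0 : ℂ) ρ).indicator (fun w => f (c + w)) z := by
    rw [← integral_indicator Metric.isOpen_ball.measurableSet,
      ← integral_add_left_eq_self _ c]
    congr 1
    ext w
    simp [Set.indicator]
  rw [h1, ← Complex.integral_comp_polarCoord_symm]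
  have h2 : ∀ q ∈ polarCoord.target,
      q.1 • (Metric.ball (0 : ℂ) ρ).indicator (fun w => f (c + w)) (Complex.polarCoord.symm q)
      = (Set.Ioo 0 ρ ×ˢ Set.Ioo (-Real.pi) Real.pi).indicator
        (fun q : ℝ × ℝ => (q.1 : ℂ) * f (circleMap c q.1 q.2)) q := by
    rintro ⟨r, θ⟩ ⟨hr, hθ⟩
    have hr' : 0 < r := hr
    have hθ' : θ ∈ Set.Ioo (-Real.pi) Real.pi := hθ
    simp only [Set.indicator, Metric.mem_ball, dist_zero_right, Complex.norm_polarCoord_symm,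
      Set.mem_prod, Set.mem_Ioo, hr', abs_of_pos hr', hθ'.1, hθ'.2, true_and, and_true]
    split_ifs
    · simp [circleMap, Complex.exp_mul_I]
    · simp
  rw [setIntegral_congr_fun polarCoord.open_target.measurableSet h2,
    setIntegral_indicator (measurableSet_Ioo.prod measurableSet_Ioo)]
  have h3 : polarCoord.target ∩ (Set.Ioo 0 ρ ×ˢ Set.Ioo (-Real.pi) Real.pi)
      = Set.Ioo 0 ρ ×ˢ Set.Ioo (-Real.pi) Real.pi := by
    rw [Set.inter_eq_right]
    rintro ⟨r, θ⟩ ⟨hr, hθ⟩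
    exact ⟨hr.1, hθ⟩
  rw [h3]
  have hint : IntegrableOn (fun q : ℝ × ℝ => (q.1 : ℂ) * f (circleMap c q.1 q.2))
      (Set.Ioo 0 ρ ×ˢ Set.Ioo (-Real.pi) Real.pi) (volume.prod volume) := by
    have : IntegrableOn (fun q : ℝ × ℝ => (q.1 : ℂ) * f (circleMap c q.1 q.2))
      (Set.Icc 0 ρ ×ˢ Set.Icc (-Real.pi) Real.pi) (volume.prod volume) := by
      apply ContinuousOn.integrableOn_compact (isCompact_Icc.prod isCompact_Icc)
      apply ContinuousOn.mul (by fun_prop)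
      apply hcont.comp (by unfold circleMap; fun_prop)
      rintro ⟨r, θ⟩ ⟨hr, -⟩
      have : |r| < R := by rw [abs_of_nonneg hr.1]; exact hr.2.trans_lt hρR
      simpa [circleMap] using this
    exact this.mono_set (Set.prod_mono Set.Ioo_subset_Icc_self Set.Ioo_subset_Icc_self)
  rw [Measure.volume_eq_prod, setIntegral_prod _ hint]
  have h4 : ∀ r ∈ Set.Ioo 0 ρ, ∫ θ in Set.Ioo (-Real.pi) Real.pi, (r : ℂ) * f (circleMap c r θ)
      = ((2 * Real.pi * r : ℝ) : ℂ) * f c := by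
    intro r hr
    have hsub : Metric.closedBall c |r| ⊆ Metric.ball c R := by
      apply Metric.closedBall_subset_ball
      rw [abs_of_pos hr.1]
      exact hr.2.trans hρR
    have h5 : Real.circleAverage f c r = f c := by
      apply circleAverage_of_differentiable_on_off_countable (s := ∅) Set.countable_empty
      · exact hcont.mono hsub
      · intro z hz
        exact hf.differentiableAt (Metric.isOpen_ball.mem_nhds
          (hsub (Metric.ball_subset_closedBall hz.1)))
    rw [Real.circleAverage_eq_integral_add (-Real.pi), intervalIntegral.integral_comp_add_right
      (fun θ => f (circleMap c r θ))] at h5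
    rw [integral_const_mul, ← integral_Ioc_eq_integral_Ioo, ← intervalIntegral.integral_of_le
      (by linarith [Real.pi_pos]), ← h5]
    have : 2 * Real.pi + -Real.pi = Real.pi := by ring
    rw [this, zero_add, Complex.real_smul, ← mul_assoc]
    congr 1
    push_cast
    have := Real.pi_ne_zero
    field_simp
  rw [setIntegral_congr_fun measurableSet_Ioo h4, integral_mul_const, integral_complex_ofReal,
    ← integral_Ioc_eq_integral_Ioo, ← intervalIntegral.integral_of_le hρ.le,
    intervalIntegral.integral_const_mul, integral_id]
  congr 2
  ring

theorem convexOn_norm_rpow {p : ℝ} (hp : 1 ≤ p) :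
    ConvexOn ℝ Set.univ (fun z : ℂ => ‖z‖ ^ p) := by
  refine ⟨convex_univ, fun x _ y _ a b ha hb hab => ?_⟩
  calc ‖a • x + b • y‖ ^ p ≤ (a • ‖x‖ + b • ‖y‖) ^ p := by
        apply Real.rpow_le_rpow (norm_nonneg _) _ (by linarith)
        refine (norm_add_le _ _).trans_eq ?_
        rw [norm_smul, norm_smul, Real.norm_of_nonneg ha, Real.norm_of_nonneg hb, smul_eq_mul,
          smul_eq_mul]
    _ ≤ a • ‖x‖ ^ p + b • ‖y‖ ^ p :=
        (convexOn_rpow hp).2 (norm_nonneg x) (norm_nonneg y) ha hb hab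

/-- The sub-mean value property of `|f|^p` over discs, for holomorphic `f` and `1 ≤ p`. -/
theorem ofReal_norm_rpow_mul_volume_ball_le {f : ℂ → ℂ} {c : ℂ} {R ρ p : ℝ} (hp : 1 ≤ p)
    (hf : DifferentiableOn ℂ f (Metric.ball c R)) (hρ : 0 < ρ) (hρR : ρ < R) :
    ENNReal.ofReal (‖f c‖ ^ p) * volume (Metric.ball c ρ)
      ≤ ∫⁻ z in Metric.ball c ρ, ENNReal.ofReal (‖f z‖ ^ p) := by
  have hsub : Metric.closedBall c ρ ⊆ Metric.ball c R := Metric.closedBall_subset_ball hρR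
  have hcont : ContinuousOn f (Metric.closedBall c ρ) := hf.continuousOn.mono hsub
  have hv0 : volume (Metric.ball c ρ) ≠ 0 := (Metric.measure_ball_pos _ _ hρ).ne'
  have hvt : volume (Metric.ball c ρ) ≠ ∞ := measure_ball_lt_top.ne
  have hfi : IntegrableOn f (Metric.ball c ρ) :=
    (hcont.integrableOn_compact (isCompact_closedBall c ρ)).mono_set Metric.ball_subset_closedBall
  have hcp : Continuous (fun z : ℂ => ‖z‖ ^ p) := by
    exact continuous_norm.rpow_const fun _ => Or.inr (by linarith)
  have hgi : IntegrableOn (fun z => ‖f z‖ ^ p) (Metric.ball c ρ) :=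
    ((hcp.comp_continuousOn hcont).integrableOn_compact
      (isCompact_closedBall c ρ)).mono_set Metric.ball_subset_closedBall
  have hvr : volume.real (Metric.ball c ρ) = Real.pi * ρ ^ 2 := by
    rw [measureReal_def, Complex.volume_ball]
    simp [ENNReal.toReal_ofReal hρ.le]
    ring
  -- Jensen's inequality for the average over the disc, whose value is `f c`.
  have hJ := (convexOn_norm_rpow hp).map_set_average_le hcp.continuousOn isClosed_univ hv0 hvt
    (by simp) hfi hgi
  have hpi := Real.pi_pos
  have hav : ⨍ z in Metric.ball c ρ, f z = f c := by
    rw [setAverage_eq, integral_ball_eq_of_differentiableOn hf hρ hρR, hvr, Complex.real_smul,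
      ← mul_assoc]
    have : ((Real.pi * ρ ^ 2 : ℝ) : ℂ) ≠ 0 := by
      exact_mod_cast (by positivity : Real.pi * ρ ^ 2 ≠ 0)
    rw [Complex.ofReal_inv, inv_mul_cancel₀ this, one_mul]
  simp only [hav, setAverage_eq, smul_eq_mul, hvr] at hJ
  rw [← ofReal_integral_eq_lintegral_ofReal hgi (by filter_upwards with z; positivity),
    ← ENNReal.ofReal_toReal hvt, ← measureReal_def, hvr, ← ENNReal.ofReal_mul (by positivity)]
  apply ENNReal.ofReal_le_ofReal
  rw [inv_mul_eq_div, le_div_iff₀ (by positivity)] at hJ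
  exact hJ

/-! ### From the tent norm to pointwise growth. -/

/-- The vertex of the box lies on the ray of z at modulus 2|z|-1, twice as far from the circle as z.
Writing w = z(1+v), the angular deviation is the imaginary part of log(1+v), at most (3/2)|v|. -/
theorem mem_carlesonBox_of_mem_ball {z w : ℂ} (hz : 1 / 2 < ‖z‖) (hz1 : ‖z‖ < 1)
    (hw : w ∈ Metric.ball z ((1 - ‖z‖) / 4)) :
    w ∈ carlesonBox (((2 * ‖z‖ - 1) / ‖z‖ : ℝ) * z) := by
  have hz0 : z ≠ 0 := norm_pos_iff.1 (by linarith)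
  have hc : 0 < (2 * ‖z‖ - 1) / ‖z‖ := div_pos (by linarith) (by linarith)
  have hnorm : ‖(((2 * ‖z‖ - 1) / ‖z‖ : ℝ) : ℂ) * z‖ = 2 * ‖z‖ - 1 := by
    rw [norm_mul, Complex.norm_real, Real.norm_of_nonneg hc.le,
      div_mul_cancel₀ _ (norm_ne_zero_iff.2 hz0)]
  have hne : (((2 * ‖z‖ - 1) / ‖z‖ : ℝ) : ℂ) * z ≠ 0 :=
    mul_ne_zero (by exact_mod_cast hc.ne') hz0
  rw [Metric.mem_ball, dist_eq_norm] at hw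
  have hwz : |‖w‖ - ‖z‖| ≤ ‖w - z‖ := abs_norm_sub_norm_le w z
  rw [abs_le] at hwz
  set v := (w - z) / z with hv
  have hwv : w = z * (1 + v) := by
    rw [hv]; field_simp; ring
  have hvn : ‖v‖ ≤ (1 - ‖z‖) / 2 := by
    rw [hv, norm_div, div_le_iff₀ (by linarith)]
    nlinarith
  have hlog := Complex.norm_log_one_add_half_le_self (z := v) (by linarith)
  have harg : |Complex.arg (1 + v)| ≤ (1 - ‖z‖) := by
    rw [← Complex.log_im]
    exact (Complex.abs_im_le_norm _).trans (by linarith)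
  rw [carlesonBox, if_neg hne, hnorm, Complex.arg_real_mul _ hc]
  refine ⟨‖w‖, Complex.arg z + Complex.arg (1 + v), ?_, ?_, by linarith, by linarith⟩
  · conv_lhs => rw [hwv, ← Complex.norm_mul_exp_arg_mul_I z, ← Complex.norm_mul_exp_arg_mul_I (1 + v)]
    rw [hwv, norm_mul]
    push_cast
    rw [add_mul, Complex.exp_add]
    ring
  · rw [add_sub_cancel_left]
    linarith

/-- An essential supremum only sees sets of positive measure. The second condition on u says that u
lies in the approach region of its radial projection; that region is defined by a strict inequality,
so u also lies in the regions of all nearby boundary points. -/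
theorem boxAverage_le_tentNorm_rpow {ζ p α : ℝ} (hp : 1 ≤ p) (f : ℂ → ℂ) {u : ℂ}
    (hu : ‖u‖ < 1) (huζ : 1 < ζ * (1 + ‖u‖)) :
    boxAverage p α f u ≤ tentNorm ζ p α f ^ p := by
  rw [tentNorm, ← ENNReal.rpow_mul, one_div_mul_cancel (by linarith), ENNReal.rpow_one]
  by_contra! hlt
  have hae := ae_lt_of_essSup_lt hlt
  have hpi := Real.pi_pos
  obtain ⟨θ₀, hθ₀, hexp⟩ : ∃ θ₀ ∈ Set.Ioc 0 (2 * Real.pi),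
      Complex.exp ((θ₀ : ℂ) * Complex.I) = Complex.exp ((Complex.arg u : ℂ) * Complex.I) := by
    rcases lt_or_ge 0 (Complex.arg u) with h | h
    · exact ⟨Complex.arg u, ⟨h, by linarith [Complex.arg_le_pi u]⟩, rfl⟩
    · refine ⟨Complex.arg u + 2 * Real.pi, ⟨by linarith [Complex.neg_pi_lt_arg u], by linarith⟩, ?_⟩
      push_cast
      rw [add_mul, Complex.exp_add, Complex.exp_two_pi_mul_I, mul_one]
  set V : Set ℝ := {θ | ‖u - Complex.exp ((θ : ℂ) * Complex.I)‖ < ζ * (1 - ‖u‖ ^ 2)} with hV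
  have hVo : IsOpen V := by
    apply isOpen_lt _ continuous_const
    fun_prop
  have hθV : θ₀ ∈ V := by
    have h1 : u - Complex.exp ((θ₀ : ℂ) * Complex.I)
        = ((‖u‖ - 1 : ℝ) : ℂ) * Complex.exp ((Complex.arg u : ℂ) * Complex.I) := by
      rw [hexp]
      push_cast
      linear_combination -(Complex.norm_mul_exp_arg_mul_I u)
    rw [hV, Set.mem_ofPred_eq, h1, norm_mul, Complex.norm_exp_ofReal_mul_I, Complex.norm_real,
      Real.norm_eq_abs, abs_of_nonpos (by linarith)]
    nlinarith
  -- θ₀ may be the endpoint 2π, so it is only known to lie in the closure of the open interval.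
  have hpos : 0 < volume (V ∩ Set.Ioo 0 (2 * Real.pi)) := by
    refine (hVo.inter isOpen_Ioo).measure_pos volume ?_
    have hcl : θ₀ ∈ closure (Set.Ioo 0 (2 * Real.pi)) := by
      rw [closure_Ioo (by linarith)]
      exact ⟨hθ₀.1.le, hθ₀.2⟩
    exact mem_closure_iff.1 hcl V hVo hθV
  rw [ae_restrict_iff' measurableSet_Ioc] at hae
  refine hpos.ne' (measure_mono_null ?_ hae)
  rintro θ ⟨hθ, hθI⟩ hcon
  have := hcon ⟨hθI.1, hθI.2.le⟩
  have hle : boxAverage p α f u ≤ ⨆ u ∈ approachRegion ζ (Complex.exp ((θ : ℂ) * Complex.I)),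
      boxAverage p α f u :=
    le_iSup₂_of_le (f := fun u (_ : u ∈ approachRegion ζ (Complex.exp ((θ : ℂ) * Complex.I))) =>
      boxAverage p α f u) u ⟨by simpa [unitDisc] using hu, hθ⟩ le_rfl
  exact absurd this (not_lt.2 hle)

theorem tentNorm_le_of_boxAverage_le {ζ p α : ℝ} (hp : 1 ≤ p) {f : ℂ → ℂ} {K : ℝ≥0∞}
    (h : ∀ u ∈ unitDisc, boxAverage p α f u ≤ K) : tentNorm ζ p α f ≤ K ^ (1 / p) := by
  apply ENNReal.rpow_le_rpow _ (by positivity)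
  exact essSup_le_of_ae_le _ (.of_forall fun θ => iSup₂_le fun u hu => h u hu.1)

theorem differentiableOn_ball_of_unitDisc {f : ℂ → ℂ} (hf : DifferentiableOn ℂ f unitDisc) {z : ℂ} :
    DifferentiableOn ℂ f (Metric.ball z (1 - ‖z‖)) :=
  hf.mono (Metric.ball_subset_ball' (by simp))

/-- Growth of a holomorphic function of finite tent norm, near the unit circle. -/
theorem exists_norm_rpow_le_near_boundary (ζ : ℝ) {p α : ℝ} (hp : 1 ≤ p) :
    ∃ K : ℝ, 0 < K ∧ ∀ f : ℂ → ℂ, DifferentiableOn ℂ f unitDisc → tentNorm ζ p α f < ∞ →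
      ∀ z : ℂ, 1 / 2 < ‖z‖ → ‖z‖ < 1 → 1 < ζ * (2 * ‖z‖) →
        ‖f z‖ ^ p ≤ K * (tentNorm ζ p α f).toReal ^ p * (1 - ‖z‖) ^ (-(α + 2)) := by
  -- For w in the small disc, (1-|w|²)/δ lies in [3/4, 5/2]; the minimum covers both signs of α+1.
  set c := min ((3 / 4 : ℝ) ^ (α + 1)) ((5 / 2 : ℝ) ^ (α + 1)) with hc
  have hc0 : 0 < c := by positivity
  have hcb : ∀ x : ℝ, 3 / 4 ≤ x → x ≤ 5 / 2 → c ≤ x ^ (α + 1) := by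
    intro x h1 h2
    rcases le_total 0 (α + 1) with h | h
    · exact (min_le_left _ _).trans (Real.rpow_le_rpow (by norm_num) h1 h)
    · exact (min_le_right _ _).trans (Real.rpow_le_rpow_of_nonpos (by linarith) h2 h)
  -- 64 = 4 · 16: the 4 from 1-|u|² ≤ 4δ, the 16 from the area of the disc of radius δ/4.
  refine ⟨64 / c, by positivity, fun f hf hN z hz hz1 hzζ => ?_⟩
  set δ := 1 - ‖z‖ with hδ
  have hδ0 : 0 < δ := by linarith
  set N := (tentNorm ζ p α f).toReal with hNdef
  have hz0 : z ≠ 0 := norm_pos_iff.1 (by linarith)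
  set u : ℂ := ((2 * ‖z‖ - 1) / ‖z‖ : ℝ) * z with hu
  have hk : 0 < (2 * ‖z‖ - 1) / ‖z‖ := div_pos (by linarith) (by linarith)
  have hnu : ‖u‖ = 2 * ‖z‖ - 1 := by
    rw [hu, norm_mul, Complex.norm_real, Real.norm_of_nonneg hk.le,
      div_mul_cancel₀ _ (norm_ne_zero_iff.2 hz0)]
  have hbox := boxAverage_le_tentNorm_rpow (α := α) hp f (u := u) (by linarith) (ζ := ζ)
    (by rw [hnu]; linarith)
  have hmean := ofReal_norm_rpow_mul_volume_ball_le hp (differentiableOn_ball_of_unitDisc hf (z := z))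
    (ρ := δ / 4) (by positivity) (by linarith)
  have hpi := Real.pi_pos
  have hlow : ENNReal.ofReal (c * δ ^ (α + 1)) * ∫⁻ w in Metric.ball z (δ / 4),
      ENNReal.ofReal (‖f w‖ ^ p) ≤
      ∫⁻ w in carlesonBox u, ENNReal.ofReal (‖f w‖ ^ p * (1 - ‖w‖ ^ 2) ^ (α + 1)) := by
    rw [← lintegral_const_mul' _ _ ENNReal.ofReal_ne_top]
    refine le_trans ?_ (lintegral_mono_set fun w hw => mem_carlesonBox_of_mem_ball hz hz1 hw)
    apply setLIntegral_mono' Metric.isOpen_ball.measurableSet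
    intro w hw
    rw [← ENNReal.ofReal_mul (by positivity), mul_comm]
    apply ENNReal.ofReal_le_ofReal
    apply mul_le_mul_of_nonneg_left _ (by positivity)
    rw [Metric.mem_ball, dist_eq_norm] at hw
    have hwz : |‖w‖ - ‖z‖| ≤ ‖w - z‖ := abs_norm_sub_norm_le w z
    rw [abs_le] at hwz
    have h1 : 1 - ‖w‖ ^ 2 = ((1 - ‖w‖ ^ 2) / δ) * δ := by field_simp
    have h2 : 3 / 4 ≤ (1 - ‖w‖ ^ 2) / δ := by
      rw [le_div_iff₀ hδ0]; nlinarith [norm_nonneg w]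
    have h3 : (1 - ‖w‖ ^ 2) / δ ≤ 5 / 2 := by
      rw [div_le_iff₀ hδ0]; nlinarith [norm_nonneg w]
    rw [h1, Real.mul_rpow (by linarith) hδ0.le]
    exact mul_le_mul_of_nonneg_right (hcb _ h2 h3) (by positivity)
  have hfin : ENNReal.ofReal (1 / (1 - ‖u‖ ^ 2)) * (ENNReal.ofReal (1 / Real.pi) *
      (ENNReal.ofReal (c * δ ^ (α + 1)) * (ENNReal.ofReal (‖f z‖ ^ p) *
        volume (Metric.ball z (δ / 4))))) ≤ ENNReal.ofReal (N ^ p) := by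
    have hNe : ENNReal.ofReal (N ^ p) = tentNorm ζ p α f ^ p := by
      rw [← ENNReal.ofReal_rpow_of_nonneg ENNReal.toReal_nonneg (by linarith),
        ENNReal.ofReal_toReal hN.ne]
    rw [hNe]
    refine le_trans ?_ hbox
    rw [boxAverage, areaMeasure, Measure.restrict_smul, lintegral_smul_measure, smul_eq_mul]
    gcongr
    refine le_trans ?_ hlow
    gcongr
  have hvol : volume (Metric.ball z (δ / 4)) = ENNReal.ofReal (Real.pi * (δ / 4) ^ 2) := by
    rw [Complex.volume_ball, ENNReal.ofReal_mul hpi.le, ENNReal.ofReal_pow (by positivity),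
      mul_comm]
    congr 1
    rw [← NNReal.coe_real_pi, ENNReal.ofReal_coe_nnreal]
  have hu1 : 0 < 1 - ‖u‖ ^ 2 := by rw [hnu]; nlinarith
  rw [hvol, ← ENNReal.ofReal_mul (by positivity), ← ENNReal.ofReal_mul (by positivity),
    ← ENNReal.ofReal_mul (by positivity), ← ENNReal.ofReal_mul (by positivity),
    ENNReal.ofReal_le_ofReal_iff (by positivity)] at hfin
  have hu2 : 1 - ‖u‖ ^ 2 ≤ 4 * δ := by rw [hnu, hδ]; nlinarith
  have hδp : δ ^ (-(α + 2)) = (δ ^ (α + 1) * δ)⁻¹ := by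
    rw [Real.rpow_neg hδ0.le, ← Real.rpow_add_one hδ0.ne']
    congr 2; ring
  rw [hδp]
  have hE : 0 < δ ^ (α + 1) := by positivity
  set E := δ ^ (α + 1)
  set F := ‖f z‖ ^ p
  have hF : 0 ≤ F := by positivity
  have h5 : 1 / (4 * δ) ≤ 1 / (1 - ‖u‖ ^ 2) := one_div_le_one_div_of_le hu1 hu2
  have h6 : 1 / (4 * δ) * (1 / Real.pi * (c * E * (F * (Real.pi * (δ / 4) ^ 2)))) ≤ N ^ p :=
    (mul_le_mul_of_nonneg_right h5 (by positivity)).trans hfin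
  have h7 : 1 / (4 * δ) * (1 / Real.pi * (c * E * (F * (Real.pi * (δ / 4) ^ 2))))
      = c * E * δ * F / 64 := by field_simp; ring
  rw [h7] at h6
  rw [← div_eq_mul_inv, le_div_iff₀ (by positivity), div_mul_eq_mul_div, le_div_iff₀ hc0]
  linarith

/-! ### Box integrals of weights singular at 1. -/

theorem lintegral_Ioc_rpow {s h : ℝ} (hs : -1 < s) (hh : 0 ≤ h) :
    ∫⁻ x in Set.Ioc 0 h, ENNReal.ofReal (x ^ s) = ENNReal.ofReal (h ^ (s + 1) / (s + 1)) := by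
  have hi : IntervalIntegrable (fun x : ℝ => x ^ s) volume 0 h :=
    intervalIntegral.intervalIntegrable_rpow' hs
  rw [intervalIntegrable_iff_integrableOn_Ioc_of_le hh] at hi
  rw [← ofReal_integral_eq_lintegral_ofReal hi, ← intervalIntegral.integral_of_le hh,
    integral_rpow (Or.inl hs), Real.zero_rpow (by linarith), sub_zero]
  filter_upwards [ae_restrict_mem measurableSet_Ioc] with x hx
  exact Real.rpow_nonneg hx.1.le _

theorem lintegral_Ico_one_sub_rpow {s h : ℝ} (hs : -1 < s) (hh : 0 ≤ h) :
    ∫⁻ r in Set.Ico (1 - h) 1, ENNReal.ofReal ((1 - r) ^ s)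
      = ENNReal.ofReal (h ^ (s + 1) / (s + 1)) := by
  rw [← lintegral_Ioc_rpow hs hh, ← lintegral_indicator measurableSet_Ico,
    ← lintegral_indicator measurableSet_Ioc, ← lintegral_sub_left_eq_self _ 1]
  congr 1
  ext x
  simp only [Set.indicator, Set.mem_Ico, Set.mem_Ioc, sub_sub_cancel]
  congr 1
  rw [eq_iff_iff]
  constructor <;> rintro ⟨h1, h2⟩ <;> constructor <;> linarith

/-- Where |x| > h the integrand is below h^(-b), and A has measure at most 7h; the part |x| ≤ h is
integrated exactly, once for each sign. -/
theorem lintegral_abs_rpow_neg_le {b h : ℝ} (hb0 : 0 < b) (hb1 : b < 1) (hh : 0 < h) {A : Set ℝ}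
    (hA : MeasurableSet A) (hAv : volume A ≤ ENNReal.ofReal (7 * h)) :
    ∫⁻ x in A, ENNReal.ofReal (|x| ^ (-b)) ≤ ENNReal.ofReal ((7 + 2 / (1 - b)) * h ^ (1 - b)) := by
  set G : ℝ → ℝ≥0∞ := (Set.Ioc 0 h).indicator fun x => ENNReal.ofReal (x ^ (-b)) with hG
  have hGm : Measurable G := by
    apply Measurable.indicator _ measurableSet_Ioc
    fun_prop
  have hGi : ∫⁻ x, G x = ENNReal.ofReal (h ^ (1 - b) / (1 - b)) := by
    rw [hG, lintegral_indicator measurableSet_Ioc, lintegral_Ioc_rpow (by linarith) hh.le,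
      neg_add_eq_sub]
  have hpt : ∀ x, A.indicator (fun x => ENNReal.ofReal (|x| ^ (-b))) x
      ≤ A.indicator (fun _ => ENNReal.ofReal (h ^ (-b))) x + (G x + G (-x)) := by
    intro x
    by_cases hx : x ∈ A
    · rw [Set.indicator_of_mem hx, Set.indicator_of_mem hx]
      rcases lt_or_ge h |x| with h1 | h1
      · exact le_add_right (ENNReal.ofReal_le_ofReal
          (Real.rpow_le_rpow_of_nonpos hh h1.le (by linarith)))
      · rcases lt_trichotomy x 0 with h2 | h2 | h2
        · have : -x ∈ Set.Ioc 0 h := ⟨by linarith, by rwa [abs_of_neg h2] at h1⟩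
          rw [abs_of_neg h2, hG, Set.indicator_of_mem this]
          exact le_add_left (le_add_left le_rfl)
        -- Here 0 ^ (-b) is 0 by convention.
        · simp [h2, Real.zero_rpow (neg_ne_zero.2 hb0.ne')]
        · have : x ∈ Set.Ioc 0 h := ⟨h2, by rwa [abs_of_pos h2] at h1⟩
          rw [abs_of_pos h2, hG, Set.indicator_of_mem this]
          exact le_add_left (le_add_right le_rfl)
    · rw [Set.indicator_of_notMem hx]
      exact zero_le
  rw [← lintegral_indicator hA]
  refine (lintegral_mono hpt).trans ?_
  rw [lintegral_add_left (measurable_const.indicator hA), lintegral_add_left hGm,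
    lintegral_neg_eq_self (f := G), hGi, lintegral_indicator hA, setLIntegral_const,
    ← ENNReal.ofReal_add (by have : 0 < 1 - b := by linarith
                             positivity) (by have : 0 < 1 - b := by linarith
                                             positivity)]
  have h1b : 0 < 1 - b := by linarith
  calc _ ≤ ENNReal.ofReal (h ^ (-b)) * ENNReal.ofReal (7 * h)
        + ENNReal.ofReal (h ^ (1 - b) / (1 - b) + h ^ (1 - b) / (1 - b)) := by gcongr
    _ = _ := by
      rw [← ENNReal.ofReal_mul (by positivity), ← ENNReal.ofReal_add (by positivity)
        (by positivity)]
      congr 1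
      have : h ^ (1 - b) = h ^ (-b) * h := by
        rw [← Real.rpow_add_one hh.ne']; congr 1; ring
      rw [this]
      ring

/-- For |θ| ≤ π/2 use |1-z|² = sin²θ + (r - cos θ)² and Jordan's inequality; otherwise cos θ ≤ 0, so
|1-z| ≥ 1. -/
theorem abs_arg_le_norm_one_sub {r θ : ℝ} (hr : 0 < r) (hθ : |θ| ≤ Real.pi) :
    |θ| / (2 * Real.pi) ≤ ‖1 - Complex.polarCoord.symm (r, θ)‖ := by
  have hpi := Real.pi_pos
  have hsq : ‖1 - Complex.polarCoord.symm (r, θ)‖ ^ 2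
      = (1 - r * Real.cos θ) ^ 2 + (r * Real.sin θ) ^ 2 := by
    rw [Complex.sq_norm, Complex.normSq_apply]
    simp [-Complex.ofReal_cos, -Complex.ofReal_sin]
    ring
  have hcs := Real.sin_sq_add_cos_sq θ
  apply le_of_sq_le_sq _ (norm_nonneg _)
  rw [hsq]
  rcases le_or_gt |θ| (Real.pi / 2) with h | h
  · have h1 := Real.mul_abs_le_abs_sin h
    have h2 : |θ| / (2 * Real.pi) ≤ |Real.sin θ| := by
      refine le_trans ?_ h1
      rw [div_mul_eq_mul_div, div_le_div_iff₀ (by positivity) (by positivity)]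
      nlinarith [abs_nonneg θ]
    have h3 : (|θ| / (2 * Real.pi)) ^ 2 ≤ Real.sin θ ^ 2 := by
      rw [← sq_abs (Real.sin θ)]
      exact pow_le_pow_left₀ (by positivity) h2 2
    nlinarith [sq_nonneg (r - Real.cos θ)]
  · have h1 : Real.cos θ ≤ 0 := by
      rw [← Real.cos_abs]
      exact Real.cos_nonpos_of_pi_div_two_le_of_le h.le (by linarith)
    have h2 : |θ| / (2 * Real.pi) ≤ 1 := by
      rw [div_le_one (by positivity)]; linarith
    have h3 : (|θ| / (2 * Real.pi)) ^ 2 ≤ 1 := pow_le_one₀ (by positivity) h2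
    nlinarith [mul_nonneg hr.le (neg_nonneg.2 h1), sq_nonneg (r * Real.cos θ)]

/-- Replacing |1-z| by a multiple of |θ| makes the integrand a product: the radial factor gives h^b
/ b and the angular one a multiple of h^(1-b). -/
theorem lintegral_polar_box_le {b : ℝ} (hb0 : 0 < b) (hb1 : b < 1) :
    ∃ K : ℝ, 0 < K ∧ ∀ (h : ℝ) (A : Set ℝ), 0 < h → MeasurableSet A →
      volume A ≤ ENNReal.ofReal (7 * h) →
      ∫⁻ z in {z : ℂ | 1 - h ≤ ‖z‖ ∧ ‖z‖ < 1 ∧ Complex.arg z ∈ A},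
        ENNReal.ofReal ((1 - ‖z‖) ^ (b - 1) * ‖1 - z‖ ^ (-b)) ≤ ENNReal.ofReal (K * h) := by
  have h1b : 0 < 1 - b := by linarith
  have hpi := Real.pi_pos
  refine ⟨1 / b * (2 * Real.pi) ^ b * (7 + 2 / (1 - b)), by positivity, fun h A hh hA hAv => ?_⟩
  set S : Set ℂ := {z : ℂ | 1 - h ≤ ‖z‖ ∧ ‖z‖ < 1 ∧ Complex.arg z ∈ A} with hS
  have hSm : MeasurableSet S :=
    (measurableSet_le measurable_const measurable_norm).inter
      ((measurableSet_lt measurable_norm measurable_const).inter (Complex.measurable_arg hA))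
  set G : ℝ → ℝ≥0∞ := (Set.Ico (1 - h) 1).indicator fun r => ENNReal.ofReal ((1 - r) ^ (b - 1))
    with hG
  set H : ℝ → ℝ≥0∞ := A.indicator fun θ =>
    ENNReal.ofReal ((2 * Real.pi) ^ b) * ENNReal.ofReal (|θ| ^ (-b)) with hH
  have hGm : Measurable G := by
    apply Measurable.indicator _ measurableSet_Ico
    fun_prop
  have hHm : Measurable H := by
    apply Measurable.indicator _ hA
    fun_prop
  rw [← lintegral_indicator hSm, ← Complex.lintegral_comp_polarCoord_symm]
  -- The majorant takes the value 0 at θ = 0 by the convention for powers of 0, so this null set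
  -- must be discarded.
  have hne : ∀ᵐ q : ℝ × ℝ, q.2 ≠ 0 := by
    have h0 : ∀ᵐ x : ℝ, x ≠ 0 := by simp [ae_iff]
    exact (Measure.quasiMeasurePreserving_snd (μ := (volume : Measure ℝ))
      (ν := (volume : Measure ℝ))).ae h0
  calc _ ≤ ∫⁻ q in polarCoord.target, G q.1 * H q.2 := by
        apply lintegral_mono_ae
        filter_upwards [ae_restrict_mem polarCoord.open_target.measurableSet,
          ae_restrict_of_ae hne] with q hq hq2
        obtain ⟨r, θ⟩ := q
        have hr : 0 < r := hq.1
        have hθ : θ ∈ Set.Ioo (-Real.pi) Real.pi := hq.2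
        by_cases hz : Complex.polarCoord.symm (r, θ) ∈ S
        · have harg : Complex.arg (Complex.polarCoord.symm (r, θ)) = θ := by
            rw [Complex.polarCoord_symm_apply]
            push_cast
            exact Complex.arg_mul_cos_add_sin_mul_I hr ⟨hθ.1, hθ.2.le⟩
          have hnorm : ‖Complex.polarCoord.symm (r, θ)‖ = r := by
            rw [Complex.norm_polarCoord_symm, abs_of_pos hr]
          rw [Set.indicator_of_mem hz]
          rw [hS, Set.mem_ofPred_eq, harg, hnorm] at hz
          rw [hG, hH, Set.indicator_of_mem (show r ∈ Set.Ico (1 - h) 1 from ⟨hz.1, hz.2.1⟩),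
            Set.indicator_of_mem hz.2.2, hnorm, smul_eq_mul,
            ← ENNReal.ofReal_mul hr.le, ← ENNReal.ofReal_mul (by positivity),
            ← ENNReal.ofReal_mul (Real.rpow_nonneg (by linarith) _)]
          apply ENNReal.ofReal_le_ofReal
          have hr1 : 0 < 1 - r := by linarith [hz.2.1]
          have h1 := abs_arg_le_norm_one_sub hr (abs_le.2 ⟨hθ.1.le, hθ.2.le⟩)
          have hθ0 : 0 < |θ| := abs_pos.2 hq2
          have h2 := Real.rpow_le_rpow_of_nonpos (by positivity) h1 (by linarith : -b ≤ 0)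
          have h3 : (|θ| / (2 * Real.pi)) ^ (-b) = (2 * Real.pi) ^ b * |θ| ^ (-b) := by
            rw [Real.div_rpow hθ0.le (by positivity), Real.rpow_neg (by positivity : 0 ≤ 2 * Real.pi),
              div_inv_eq_mul, mul_comm]
          rw [h3] at h2
          -- The Jacobian r is below 1.
          calc _ ≤ 1 * ((1 - r) ^ (b - 1) * ‖1 - Complex.polarCoord.symm (r, θ)‖ ^ (-b)) := by
                apply mul_le_mul_of_nonneg_right hz.2.1.le (by positivity)
            _ ≤ _ := by
                rw [one_mul]
                exact mul_le_mul_of_nonneg_left h2 (by positivity)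
        · rw [Set.indicator_of_notMem hz, smul_zero]
          exact zero_le
    _ ≤ ∫⁻ q : ℝ × ℝ, G q.1 * H q.2 := setLIntegral_le_lintegral _ _
    _ = (∫⁻ r, G r) * ∫⁻ θ, H θ := by
        rw [Measure.volume_eq_prod]
        exact lintegral_prod_mul hGm.aemeasurable hHm.aemeasurable
    _ ≤ ENNReal.ofReal (h ^ b / b) * (ENNReal.ofReal ((2 * Real.pi) ^ b) *
          ENNReal.ofReal ((7 + 2 / (1 - b)) * h ^ (1 - b))) := by
        rw [hG, hH, lintegral_indicator measurableSet_Ico, lintegral_indicator hA,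
          lintegral_Ico_one_sub_rpow (by linarith) hh.le, sub_add_cancel,
          lintegral_const_mul' _ _ ENNReal.ofReal_ne_top]
        gcongr
        exact lintegral_abs_rpow_neg_le hb0 hb1 hh hA hAv
    _ = _ := by
        rw [← ENNReal.ofReal_mul (by positivity), ← ENNReal.ofReal_mul (by positivity)]
        congr 1
        have : h ^ b * h ^ (1 - b) = h := by
          rw [← Real.rpow_add hh]; simp
        calc _ = 1 / b * (2 * Real.pi) ^ b * (7 + 2 / (1 - b)) * (h ^ b * h ^ (1 - b)) := by ring
          _ = _ := by rw [this]

/-- The angular interval of the box can cross the cut of the argument, so its translates by ±2π are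
included, for a total of 3h. The constant 7 is needed only at u = 0, where the full circle requires
2π ≤ 7. -/
theorem carlesonBox_subset_polar_box {u : ℂ} (hu : ‖u‖ < 1) :
    ∃ A : Set ℝ, MeasurableSet A ∧ volume A ≤ ENNReal.ofReal (7 * (1 - ‖u‖)) ∧
      carlesonBox u ⊆ {z : ℂ | 1 - (1 - ‖u‖) ≤ ‖z‖ ∧ ‖z‖ < 1 ∧ Complex.arg z ∈ A} := by
  have hpi := Real.pi_gt_three
  have hpi' := Real.pi_lt_d2
  by_cases hu0 : u = 0
  · refine ⟨Set.Ioc (-Real.pi) Real.pi, measurableSet_Ioc, ?_, ?_⟩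
    · rw [Real.volume_Ioc, hu0, norm_zero]
      exact ENNReal.ofReal_le_ofReal (by linarith)
    · intro z hz
      rw [carlesonBox, if_pos hu0] at hz
      have : ‖z‖ < 1 := by simpa [unitDisc] using hz
      exact ⟨by simp [hu0], this, Complex.arg_mem_Ioc z⟩
  · set h := 1 - ‖u‖ with hh
    have hh0 : 0 < h := by linarith
    have hu1 : 0 < ‖u‖ := norm_pos_iff.2 hu0
    let I : ℝ → Set ℝ := fun x => Set.Icc (x - h / 2) (x + h / 2)
    have hI : ∀ x, volume (I x) = ENNReal.ofReal h := by
      intro x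
      rw [Real.volume_Icc]; congr 1; ring
    set φ := Complex.arg u with hφ
    have hφ1 := Complex.neg_pi_lt_arg u
    have hφ2 := Complex.arg_le_pi u
    refine ⟨I (φ - 2 * Real.pi) ∪ (I φ ∪ I (φ + 2 * Real.pi)),
      measurableSet_Icc.union (measurableSet_Icc.union measurableSet_Icc), ?_, ?_⟩
    · refine (measure_union_le _ _).trans ((add_le_add_right (measure_union_le _ _) _).trans ?_)
      rw [hI, hI, hI, ← ENNReal.ofReal_add hh0.le hh0.le,
        ← ENNReal.ofReal_add hh0.le (by linarith)]
      exact ENNReal.ofReal_le_ofReal (by linarith)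
    · intro z hz
      rw [carlesonBox, if_neg hu0] at hz
      obtain ⟨l, t, rfl, ht, hl, hl1⟩ := hz
      have hl0 : 0 < l := by linarith
      have hn : ‖(l : ℂ) * Complex.exp ((t : ℂ) * Complex.I)‖ = l := by
        rw [norm_mul, Complex.norm_exp_ofReal_mul_I, Complex.norm_real, Real.norm_of_nonneg hl0.le,
          mul_one]
      refine ⟨by rw [hn]; linarith, by rw [hn]; exact hl1, ?_⟩
      rw [Complex.arg_real_mul _ hl0, Complex.arg_exp_mul_I]
      have hm := toIocMod_mem_Ioc Real.two_pi_pos (-Real.pi) t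
      have hd := toIocMod_add_toIocDiv_zsmul Real.two_pi_pos (-Real.pi) t
      set x := toIocMod Real.two_pi_pos (-Real.pi) t
      set k := toIocDiv Real.two_pi_pos (-Real.pi) t
      rw [zsmul_eq_mul] at hd
      rw [abs_le] at ht
      have hk1 : (-2 : ℝ) < k := by nlinarith [hm.1, hm.2]
      have hk2 : (k : ℝ) < 2 := by nlinarith [hm.1, hm.2]
      have hk1' : -2 < k := by exact_mod_cast hk1
      have hk2' : k < 2 := by exact_mod_cast hk2
      simp only [Set.mem_union, I, Set.mem_Icc]
      interval_cases k
      · right; right; push_cast at hd; constructor <;> linarith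
      · right; left; push_cast at hd; constructor <;> linarith
      · left; push_cast at hd; constructor <;> linarith

/-- A pointwise bound with a singularity at `1` that implies a finite tent norm. -/
theorem exists_boxAverage_le_of_norm_le {p : ℝ} (α : ℝ) {a : ℝ} (hp : 1 ≤ p) (ha : 0 < a)
    (hap : a * p < 1) :
    ∃ K : ℝ, 0 < K ∧ ∀ (f : ℂ → ℂ) (M : ℝ), 0 ≤ M →
      (∀ z ∈ unitDisc, ‖f z‖ ≤ M * ((1 - ‖z‖) ^ (a - (α + 2) / p) * ‖1 - z‖ ^ (-a))) →
      ∀ u ∈ unitDisc, boxAverage p α f u ≤ ENNReal.ofReal (K * M ^ p) := by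
  have hp0 : 0 < p := by linarith
  have hpi := Real.pi_pos
  obtain ⟨K, hK, hKb⟩ := lintegral_polar_box_le (b := a * p) (by positivity) hap
  refine ⟨1 / Real.pi * 2 ^ |α + 1| * K, by positivity, fun f M hM hf u hu => ?_⟩
  have hu1 : ‖u‖ < 1 := by simpa [unitDisc] using hu
  obtain ⟨A, hA, hAv, hsub⟩ := carlesonBox_subset_polar_box hu1
  have hb := hKb _ A (by linarith : 0 < 1 - ‖u‖) hA hAv
  set S : Set ℂ := {z : ℂ | 1 - (1 - ‖u‖) ≤ ‖z‖ ∧ ‖z‖ < 1 ∧ Complex.arg z ∈ A} with hS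
  have hSm : MeasurableSet S :=
    (measurableSet_le measurable_const measurable_norm).inter
      ((measurableSet_lt measurable_norm measurable_const).inter (Complex.measurable_arg hA))
  have hint : ∫⁻ z in carlesonBox u, ENNReal.ofReal (‖f z‖ ^ p * (1 - ‖z‖ ^ 2) ^ (α + 1))
      ≤ ENNReal.ofReal (M ^ p * 2 ^ |α + 1|) * ENNReal.ofReal (K * (1 - ‖u‖)) := by
    refine (lintegral_mono_set hsub).trans (le_trans ?_ (mul_le_mul_right hb _))
    rw [← lintegral_const_mul' _ _ ENNReal.ofReal_ne_top]
    apply setLIntegral_mono' hSm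
    rintro z ⟨-, hz, -⟩
    rw [← ENNReal.ofReal_mul (by positivity)]
    apply ENNReal.ofReal_le_ofReal
    have hz0 : 0 < 1 - ‖z‖ := by linarith
    have h1 := Real.rpow_le_rpow (norm_nonneg _) (hf z (by simpa [unitDisc] using hz)) hp0.le
    rw [Real.mul_rpow hM (by positivity), Real.mul_rpow (by positivity) (by positivity),
      ← Real.rpow_mul hz0.le, ← Real.rpow_mul (norm_nonneg _)] at h1
    have h2 : (1 - ‖z‖ ^ 2) ^ (α + 1) ≤ (1 - ‖z‖) ^ (α + 1) * 2 ^ |α + 1| := by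
      have : 1 - ‖z‖ ^ 2 = (1 - ‖z‖) * (1 + ‖z‖) := by ring
      rw [this, Real.mul_rpow hz0.le (by positivity)]
      apply mul_le_mul_of_nonneg_left _ (by positivity)
      calc (1 + ‖z‖) ^ (α + 1) ≤ (1 + ‖z‖) ^ |α + 1| :=
            Real.rpow_le_rpow_of_exponent_le (by linarith [norm_nonneg z]) (le_abs_self _)
        _ ≤ _ := Real.rpow_le_rpow (by positivity) (by linarith) (abs_nonneg _)
    have h4 : 0 ≤ (1 - ‖z‖ ^ 2) ^ (α + 1) := Real.rpow_nonneg (by nlinarith [norm_nonneg z]) _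
    refine (mul_le_mul h1 h2 h4 (by positivity)).trans_eq ?_
    -- The exponents match because p · (α+2)/p = α+2.
    have h3 : (1 - ‖z‖) ^ (a * p - 1)
        = (1 - ‖z‖) ^ ((a - (α + 2) / p) * p) * (1 - ‖z‖) ^ (α + 1) := by
      rw [← Real.rpow_add hz0]
      congr 1
      field_simp
      ring
    rw [h3, neg_mul]
    ring
  have hu2 : 0 < 1 - ‖u‖ ^ 2 := by nlinarith [norm_nonneg u]
  have hu0 : 0 < 1 - ‖u‖ := by linarith
  rw [boxAverage, areaMeasure, Measure.restrict_smul, lintegral_smul_measure, smul_eq_mul]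
  calc _ ≤ ENNReal.ofReal (1 / (1 - ‖u‖)) * (ENNReal.ofReal (1 / Real.pi) *
        (ENNReal.ofReal (M ^ p * 2 ^ |α + 1|) * ENNReal.ofReal (K * (1 - ‖u‖)))) := by
        gcongr ENNReal.ofReal ?_ * (_ * ?_)
        · exact one_div_le_one_div_of_le hu0 (by nlinarith [norm_nonneg u])
    _ = _ := by
        rw [← ENNReal.ofReal_mul (by positivity), ← ENNReal.ofReal_mul (by positivity),
          ← ENNReal.ofReal_mul (by positivity)]
        congr 1
        field_simp

/-- Growth of functions in the analytic tent space. -/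
theorem exists_norm_le_of_mem_analyticTentSpace {ζ p : ℝ} (α : ℝ) (hζ : 1 / 2 < ζ) (hp : 1 ≤ p)
    (hα : -2 < α) :
    ∃ K : ℝ, 0 < K ∧ ∀ f ∈ analyticTentSpace ζ p α, ∀ z ∈ unitDisc,
      ‖f z‖ ≤ K * (tentNorm ζ p α f).toReal * (1 - ‖z‖) ^ (-((α + 2) / p)) := by
  have hp0 : 0 < p := by linarith
  obtain ⟨K, hK, hKb⟩ := exists_norm_rpow_le_near_boundary ζ (α := α) hp
  set γ := (α + 2) / p with hγ
  have hγ0 : 0 < γ := div_pos (by linarith) hp0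
  -- The boundary estimate applies for |z| ≥ R; ζ > 1/2 leaves room for R < 1. The disc |z| < R is
  -- handled by the maximum principle.
  obtain ⟨R, hR, hR1⟩ : ∃ R, max (1 / 2) (1 / (2 * ζ)) < R ∧ R < 1 :=
    exists_between (max_lt (by norm_num) (by rw [div_lt_one (by linarith)]; linarith))
  rw [max_lt_iff, div_lt_iff₀ (by linarith : 0 < 2 * ζ)] at hR
  have hbd : ∀ f ∈ analyticTentSpace ζ p α, ∀ z : ℂ, R ≤ ‖z‖ → ‖z‖ < 1 →
      ‖f z‖ ≤ K ^ (1 / p) * (tentNorm ζ p α f).toReal * (1 - ‖z‖) ^ (-γ) := by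
    intro f hf z hz hz1
    have hz0 : 0 < 1 - ‖z‖ := by linarith
    have h := hKb f hf.2 hf.1.2 z (by linarith) hz1 (by nlinarith)
    rw [← Real.rpow_le_rpow_iff (norm_nonneg _) (by positivity) hp0]
    refine h.trans_eq ?_
    rw [Real.mul_rpow (by positivity) (by positivity), Real.mul_rpow (by positivity) (by positivity),
      ← Real.rpow_mul hK.le, ← Real.rpow_mul hz0.le, one_div_mul_cancel hp0.ne', Real.rpow_one,
      neg_mul, hγ, div_mul_cancel₀ _ hp0.ne']
  have hone : ∀ x : ℝ, 0 < x → x ≤ 1 → 1 ≤ x ^ (-γ) := fun x h0 h1 =>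
    Real.one_le_rpow_of_pos_of_le_one_of_nonpos h0 h1 (by linarith)
  have hRo := hone (1 - R) (by linarith) (by linarith)
  refine ⟨K ^ (1 / p) * (1 - R) ^ (-γ), by positivity, fun f hf z hz => ?_⟩
  have hz1 : ‖z‖ < 1 := by simpa [unitDisc] using hz
  set N := (tentNorm ζ p α f).toReal with hN
  have hN0 : 0 ≤ N := ENNReal.toReal_nonneg
  have hz0 : 0 < 1 - ‖z‖ := by linarith
  have hzo := hone (1 - ‖z‖) hz0 (by linarith [norm_nonneg z])
  rcases le_or_gt R ‖z‖ with h | h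
  · refine (hbd f hf z h hz1).trans ?_
    apply mul_le_mul_of_nonneg_right _ (by positivity)
    apply mul_le_mul_of_nonneg_right _ hN0
    exact le_mul_of_one_le_right (by positivity) hRo
  · have hR0 : R ≠ 0 := by linarith
    have hsub : closure (Metric.ball (0 : ℂ) R) ⊆ unitDisc := by
      rw [closure_ball _ hR0]
      exact Metric.closedBall_subset_ball hR1
    have hmax : ‖f z‖ ≤ K ^ (1 / p) * N * (1 - R) ^ (-γ) := by
      refine Complex.norm_le_of_forall_mem_frontier_norm_le Metric.isBounded_ball
        (U := Metric.ball 0 R) ⟨hf.2.mono (subset_closure.trans hsub), hf.2.continuousOn.mono hsub⟩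
        (fun w hw => ?_) (subset_closure (by simpa using h))
      rw [frontier_ball _ hR0, mem_sphere_zero_iff_norm] at hw
      have := hbd f hf w hw.ge (by linarith)
      rwa [hw] at this
    refine hmax.trans ?_
    rw [mul_right_comm]
    exact le_mul_of_one_le_right (by positivity) hzo

/-! ### Integrals against Carleson measures. -/

theorem IsCarlesonMeasure.measure_one_sub_le {μ : Measure (Set.Ico (0 : ℝ) 1)} {C : ℝ} (hC : 0 < C)
    (h : ∀ t : Set.Ico (0 : ℝ) 1, μ (Set.Ici t) ≤ ENNReal.ofReal (C * (1 - (t : ℝ)))) {x : ℝ}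
    (hx : 0 < x) : μ {t | 1 - (t : ℝ) ≤ x} ≤ ENNReal.ofReal (C * x) := by
  rcases le_or_gt x 1 with h1 | h1
  · have := h ⟨1 - x, by linarith, by linarith⟩
    simp only [sub_sub_cancel] at this
    refine (measure_mono fun t ht => ?_).trans this
    have ht : 1 - (t : ℝ) ≤ x := ht
    exact Set.mem_Ici.2 (Subtype.coe_le_coe.1 (by show 1 - x ≤ (t : ℝ); linarith))
  · refine (measure_mono fun t _ => ?_).trans ((h ⟨0, by norm_num⟩).trans
      (ENNReal.ofReal_le_ofReal ?_))
    · exact Set.mem_Ici.2 (Subtype.coe_le_coe.1 (by exact t.2.1))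
    · simp only [sub_zero]
      nlinarith

/-- Dyadic decomposition: where the maximum lies between 2^k δ and 2^(k+1) δ, the integrand is at
most (2^k δ)^(-c) and the mass at most C 2^(k+1) δ. The resulting series is geometric with ratio
2^(1-c) < 1. -/
theorem IsCarlesonMeasure.exists_lintegral_le {μ : Measure (Set.Ico (0 : ℝ) 1)}
    (hμ : IsCarlesonMeasure μ) {c : ℝ} (hc : 1 < c) :
    ∃ K : ℝ, 0 < K ∧ ∀ δ : ℝ, 0 < δ →
      ∫⁻ t, ENNReal.ofReal (max δ (1 - (t : ℝ)) ^ (-c)) ∂μ ≤ ENNReal.ofReal (K * δ ^ (1 - c)) := by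
  obtain ⟨C, hC, h⟩ := hμ
  set q : ℝ := 2 ^ (1 - c) with hq
  have hq0 : 0 < q := by positivity
  have hq1 : q < 1 := Real.rpow_lt_one_of_one_lt_of_neg (by norm_num) (by linarith)
  have h1q : 0 < 1 - q := by linarith
  refine ⟨2 * C * (1 - q)⁻¹, by positivity, fun δ hδ => ?_⟩
  let E : ℕ → Set (Set.Ico (0 : ℝ) 1) := fun k => {t | 1 - (t : ℝ) ≤ 2 ^ (k + 1) * δ}
  have hE : ∀ k, MeasurableSet (E k) := fun k =>
    measurableSet_le (by fun_prop) measurable_const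
  have hpt : ∀ t : Set.Ico (0 : ℝ) 1, ENNReal.ofReal (max δ (1 - (t : ℝ)) ^ (-c)) ≤
      ∑' k, (E k).indicator (fun _ => ENNReal.ofReal ((2 ^ k * δ) ^ (-c))) t := by
    intro t
    obtain ⟨k, hk1, hk2⟩ := exists_nat_pow_near (x := max δ (1 - (t : ℝ)) / δ) (y := (2 : ℝ))
      (by rw [le_div_iff₀ hδ, one_mul]; exact le_max_left _ _) (by norm_num)
    rw [le_div_iff₀ hδ] at hk1
    rw [div_lt_iff₀ hδ] at hk2
    refine le_trans ?_ (ENNReal.le_tsum k)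
    rw [Set.indicator_of_mem (show t ∈ E k from (le_max_right _ _).trans hk2.le)]
    exact ENNReal.ofReal_le_ofReal
      (Real.rpow_le_rpow_of_nonpos (by positivity) hk1 (by linarith))
  have hterm : ∀ k : ℕ, ENNReal.ofReal ((2 ^ k * δ) ^ (-c)) * μ (E k) ≤
      ENNReal.ofReal (2 * C * δ ^ (1 - c) * q ^ k) := by
    intro k
    refine (mul_le_mul_right (IsCarlesonMeasure.measure_one_sub_le hC h
      (by positivity : 0 < 2 ^ (k + 1) * δ)) _).trans_eq ?_
    rw [← ENNReal.ofReal_mul (by positivity)]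
    congr 1
    have e1 : q ^ k = (2 ^ k : ℝ) ^ (1 - c) := by
      rw [hq, ← Real.rpow_natCast, ← Real.rpow_natCast, ← Real.rpow_mul (by norm_num),
        ← Real.rpow_mul (by norm_num), mul_comm]
    have e2 : ∀ x : ℝ, 0 < x → x ^ (1 - c) = x ^ (-c) * x := fun x hx => by
      rw [← Real.rpow_add_one hx.ne']; congr 1; ring
    rw [e1, Real.mul_rpow (by positivity) hδ.le, e2 δ hδ, e2 (2 ^ k) (by positivity)]
    ring
  calc _ ≤ ∫⁻ t, ∑' k, (E k).indicator (fun _ => ENNReal.ofReal ((2 ^ k * δ) ^ (-c))) t ∂μ :=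
        lintegral_mono hpt
    _ = ∑' k, ENNReal.ofReal ((2 ^ k * δ) ^ (-c)) * μ (E k) := by
        rw [lintegral_tsum fun k => (measurable_const.indicator (hE k)).aemeasurable]
        congr 1
        ext k
        rw [lintegral_indicator (hE k), setLIntegral_const]
    _ ≤ ∑' k, ENNReal.ofReal (2 * C * δ ^ (1 - c) * q ^ k) := ENNReal.tsum_le_tsum hterm
    _ = ENNReal.ofReal (∑' k, 2 * C * δ ^ (1 - c) * q ^ k) := by
        rw [ENNReal.ofReal_tsum_of_nonneg (fun k => by positivity)
          ((summable_geometric_of_lt_one hq0.le hq1).mul_left _)]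
    _ = _ := by
        rw [tsum_mul_left, tsum_geometric_of_lt_one hq0.le hq1]
        congr 1
        ring

/-! ### Holomorphy of C_μ f. -/

theorem mul_mem_unitDisc {z : ℂ} (hz : z ∈ unitDisc) (t : Set.Ico (0 : ℝ) 1) :
    ((t : ℝ) : ℂ) * z ∈ unitDisc := by
  have hz1 : ‖z‖ < 1 := by simpa [unitDisc] using hz
  have : ‖((t : ℝ) : ℂ) * z‖ < 1 := by
    rw [norm_mul, Complex.norm_real, Real.norm_of_nonneg t.2.1]
    nlinarith [t.2.1, t.2.2, norm_nonneg z]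
  simpa [unitDisc] using this

theorem one_sub_ne_zero_of_mem_unitDisc {z : ℂ} (hz : z ∈ unitDisc) : 1 - z ≠ 0 := by
  intro h
  rw [← sub_eq_zero.1 h] at hz
  simp [unitDisc] at hz

theorem isOpen_unitDisc : IsOpen unitDisc := Metric.isOpen_ball

theorem continuous_comp_mul {G : ℂ → ℂ} (hG : ContinuousOn G unitDisc) {z : ℂ}
    (hz : z ∈ unitDisc) : Continuous fun t : Set.Ico (0 : ℝ) 1 => G (((t : ℝ) : ℂ) * z) :=
  hG.comp_continuous (by fun_prop) (mul_mem_unitDisc hz)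

theorem exists_norm_comp_mul_le {G : ℂ → ℂ} (hG : ContinuousOn G unitDisc) {R : ℝ} (hR : R < 1) :
    ∃ B : ℝ, ∀ (t : Set.Ico (0 : ℝ) 1) (z : ℂ), ‖z‖ ≤ R → ‖G (((t : ℝ) : ℂ) * z)‖ ≤ B := by
  obtain ⟨B, hB⟩ := (isCompact_closedBall (0 : ℂ) R).exists_bound_of_continuousOn
    (hG.mono (Metric.closedBall_subset_ball hR))
  refine ⟨B, fun t z hz => hB _ ?_⟩
  rw [mem_closedBall_zero_iff, norm_mul, Complex.norm_real, Real.norm_of_nonneg t.2.1]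
  nlinarith [t.2.1, t.2.2, norm_nonneg z]

/-- Differentiation under the integral: for |z| ≤ R < 1 all points tz stay in one compact disc, so a
constant dominates the derivatives, and it is integrable as μ is finite. -/
theorem differentiableOn_integral_comp_mul (μ : Measure (Set.Ico (0 : ℝ) 1)) [IsFiniteMeasure μ]
    {G : ℂ → ℂ} (hG : DifferentiableOn ℂ G unitDisc) :
    DifferentiableOn ℂ (fun z => ∫ t : Set.Ico (0 : ℝ) 1, G (((t : ℝ) : ℂ) * z) ∂μ) unitDisc := by
  intro z hz
  have hz1 : ‖z‖ < 1 := by simpa [unitDisc] using hz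
  obtain ⟨R, hzR, hR⟩ := exists_between hz1
  have hsub : Metric.ball (0 : ℂ) R ⊆ unitDisc := Metric.ball_subset_ball hR.le
  have hdc : ContinuousOn (deriv G) unitDisc := (hG.deriv isOpen_unitDisc).continuousOn
  obtain ⟨B, hB⟩ := exists_norm_comp_mul_le hdc hR
  obtain ⟨B', hB'⟩ := exists_norm_comp_mul_le hG.continuousOn hR
  have hB0 : 0 ≤ B := (norm_nonneg _).trans (hB ⟨0, by norm_num⟩ z hzR.le)
  have hs : Metric.ball (0 : ℂ) R ∈ nhds z := Metric.isOpen_ball.mem_nhds (by simpa using hzR)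
  have key := hasDerivAt_integral_of_dominated_loc_of_deriv_le (μ := μ) (𝕜 := ℂ)
    (F := fun z (t : Set.Ico (0 : ℝ) 1) => G (((t : ℝ) : ℂ) * z))
    (F' := fun z (t : Set.Ico (0 : ℝ) 1) => deriv G (((t : ℝ) : ℂ) * z) * ((t : ℝ) : ℂ))
    (x₀ := z) (bound := fun _ => B) hs
    (by
      filter_upwards [hs] with w hw
      exact (continuous_comp_mul hG.continuousOn (hsub hw)).aestronglyMeasurable)
    (Integrable.of_bound (continuous_comp_mul hG.continuousOn hz).aestronglyMeasurable B'
      (.of_forall fun t => hB' t z hzR.le))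
    (((continuous_comp_mul hdc hz).mul (by fun_prop)).aestronglyMeasurable)
    (.of_forall fun t w hw => by
      have hw' : ‖w‖ < R := by simpa using hw
      rw [norm_mul, Complex.norm_real, Real.norm_of_nonneg t.2.1]
      exact (mul_le_of_le_one_right (norm_nonneg _) t.2.2.le).trans (hB t w hw'.le))
    (integrable_const B)
    (.of_forall fun t w hw => by
      have h1 : HasDerivAt G (deriv G (((t : ℝ) : ℂ) * w)) (((t : ℝ) : ℂ) * w) :=
        (hG.differentiableAt (isOpen_unitDisc.mem_nhds
          (mul_mem_unitDisc (hsub hw) t))).hasDerivAt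
      have h2 : HasDerivAt (fun w : ℂ => ((t : ℝ) : ℂ) * w) ((t : ℝ) : ℂ) w := by
        simpa using (hasDerivAt_id w).const_mul ((t : ℝ) : ℂ)
      exact h1.comp w h2)
  exact key.2.differentiableAt.differentiableWithinAt

theorem differentiableOn_div_one_sub {f : ℂ → ℂ} (hf : DifferentiableOn ℂ f unitDisc) :
    DifferentiableOn ℂ (fun z => f z / (1 - z)) unitDisc :=
  hf.div (by fun_prop) fun _ hz => one_sub_ne_zero_of_mem_unitDisc hz

theorem differentiableOn_cesaroLike (μ : Measure (Set.Ico (0 : ℝ) 1)) [IsFiniteMeasure μ]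
    {f : ℂ → ℂ} (hf : DifferentiableOn ℂ f unitDisc) :
    DifferentiableOn ℂ (cesaroLike μ f) unitDisc :=
  differentiableOn_integral_comp_mul μ (differentiableOn_div_one_sub hf)

theorem mem_analyticTentSpace_of_differentiableOn {ζ p α : ℝ} {f : ℂ → ℂ}
    (hf : DifferentiableOn ℂ f unitDisc) (hN : tentNorm ζ p α f < ∞) :
    f ∈ analyticTentSpace ζ p α := by
  refine ⟨⟨?_, hN⟩, hf⟩
  exact hf.continuousOn.aemeasurable isOpen_unitDisc.measurableSet

/-! ### Sufficiency of the Carleson condition. -/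

/-- Moving from tz to z costs at most 1-t, which is itself at most |1-tz|. This makes the
singularity at 1 uniform in t. -/
theorem norm_one_sub_le_two_mul {z : ℂ} (hz : ‖z‖ ≤ 1) {t : ℝ} (ht0 : 0 ≤ t) (ht1 : t ≤ 1) :
    ‖1 - z‖ ≤ 2 * ‖1 - (t : ℂ) * z‖ := by
  have h1 : 1 - z = (1 - (t : ℂ) * z) + -(((1 - t : ℝ) : ℂ) * z) := by push_cast; ring
  have h2 : ‖(((1 - t : ℝ) : ℂ) * z)‖ ≤ 1 - t := by
    rw [norm_mul, Complex.norm_real, Real.norm_of_nonneg (by linarith)]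
    exact mul_le_of_le_one_right (by linarith) hz
  have h3 : 1 - t ≤ ‖1 - (t : ℂ) * z‖ := by
    have h4 := norm_sub_norm_le (1 : ℂ) ((t : ℂ) * z)
    rw [norm_one, norm_mul, Complex.norm_real, Real.norm_of_nonneg ht0] at h4
    nlinarith
  calc ‖1 - z‖ ≤ ‖1 - (t : ℂ) * z‖ + ‖(((1 - t : ℝ) : ℂ) * z)‖ := by
        rw [h1]; refine (norm_add_le _ _).trans_eq ?_; rw [norm_neg]
    _ ≤ _ := by linarith

/-- For a Carleson measure, a growth estimate on `f` improves to one on `C_μ f` whose singularity is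
concentrated at `1`. -/
theorem IsCarlesonMeasure.exists_norm_cesaroLike_le {μ : Measure (Set.Ico (0 : ℝ) 1)}
    (hμ : IsCarlesonMeasure μ) {a γ : ℝ} (ha : 0 < a) (ha1 : a ≤ 1) (haγ : a < γ) :
    ∃ K : ℝ, 0 < K ∧ ∀ (f : ℂ → ℂ) (N : ℝ), 0 ≤ N →
      (∀ z ∈ unitDisc, ‖f z‖ ≤ N * (1 - ‖z‖) ^ (-γ)) →
      ∀ z ∈ unitDisc, ‖cesaroLike μ f z‖ ≤ K * N * ((1 - ‖z‖) ^ (a - γ) * ‖1 - z‖ ^ (-a)) := by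
  obtain ⟨K, hK, hKb⟩ := hμ.exists_lintegral_le (c := γ + 1 - a) (by linarith)
  refine ⟨2 ^ a * K, by positivity, fun f N hN hf z hz => ?_⟩
  have hz1 : ‖z‖ < 1 := by simpa [unitDisc] using hz
  have hz0 : 0 < 1 - ‖z‖ := by linarith
  have h1z : 0 < ‖1 - z‖ := norm_pos_iff.2 (one_sub_ne_zero_of_mem_unitDisc hz)
  have hpt : ∀ t : Set.Ico (0 : ℝ) 1, ‖f (((t : ℝ) : ℂ) * z) / (1 - ((t : ℝ) : ℂ) * z)‖ ≤
      N * (2 ^ a * ‖1 - z‖ ^ (-a)) * max (1 - ‖z‖) (1 - (t : ℝ)) ^ (-(γ + 1 - a)) := by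
    intro t
    have ht0 := t.2.1
    have ht1 := t.2.2
    have hw := mul_mem_unitDisc hz t
    have hfw := hf _ hw
    have hnw : ‖((t : ℝ) : ℂ) * z‖ = t * ‖z‖ := by
      rw [norm_mul, Complex.norm_real, Real.norm_of_nonneg ht0]
    rw [hnw] at hfw
    set m := max (1 - ‖z‖) (1 - (t : ℝ)) with hm
    have hm0 : 0 < m := lt_max_of_lt_left hz0
    have hmle : m ≤ 1 - t * ‖z‖ := by
      apply max_le <;> nlinarith [norm_nonneg z]
    have hd0 : 0 < 1 - t * ‖z‖ := by linarith
    have hdn : 1 - t * ‖z‖ ≤ ‖1 - ((t : ℝ) : ℂ) * z‖ := by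
      have h4 := norm_sub_norm_le (1 : ℂ) (((t : ℝ) : ℂ) * z)
      rwa [norm_one, hnw] at h4
    set D := ‖1 - ((t : ℝ) : ℂ) * z‖ with hD
    have hD0 : 0 < D := by linarith
    have h2D := norm_one_sub_le_two_mul hz1.le ht0 ht1.le
    rw [← hD] at h2D
    have e1 : (1 - t * ‖z‖) ^ (-γ) ≤ m ^ (-γ) :=
      Real.rpow_le_rpow_of_nonpos hm0 hmle (by linarith)
    have e2 : D ^ (-(1 - a)) ≤ m ^ (-(1 - a)) :=
      Real.rpow_le_rpow_of_nonpos hm0 (by linarith) (by linarith)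
    have e3 : D ^ (-a) ≤ 2 ^ a * ‖1 - z‖ ^ (-a) := by
      have : D ^ (-a) ≤ (‖1 - z‖ / 2) ^ (-a) :=
        Real.rpow_le_rpow_of_nonpos (by positivity) (by linarith) (by linarith)
      refine this.trans_eq ?_
      rw [Real.div_rpow h1z.le (by norm_num), Real.rpow_neg (by norm_num : (0 : ℝ) ≤ 2),
        div_inv_eq_mul, mul_comm]
    -- The power a of the kernel is kept as |1-z|^(-a); the remaining 1-a joins the growth of f,
    -- giving the exponent γ+1-a, which exceeds 1 because a < γ.
    have e4 : D⁻¹ = D ^ (-(1 - a)) * D ^ (-a) := by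
      rw [← Real.rpow_add hD0, ← Real.rpow_neg_one]; congr 1; ring
    have e5 : m ^ (-(γ + 1 - a)) = m ^ (-γ) * m ^ (-(1 - a)) := by
      rw [← Real.rpow_add hm0]; congr 1; ring
    rw [norm_div, div_eq_mul_inv, ← hD, e4, e5]
    calc _ ≤ (N * m ^ (-γ)) * (m ^ (-(1 - a)) * (2 ^ a * ‖1 - z‖ ^ (-a))) := by
          gcongr
          exact hfw.trans (mul_le_mul_of_nonneg_left e1 hN)
      _ = _ := by ring
  have hlin : ∫⁻ t : Set.Ico (0 : ℝ) 1,
      ENNReal.ofReal ‖f (((t : ℝ) : ℂ) * z) / (1 - ((t : ℝ) : ℂ) * z)‖ ∂μ ≤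
      ENNReal.ofReal (2 ^ a * K * N * ((1 - ‖z‖) ^ (a - γ) * ‖1 - z‖ ^ (-a))) := by
    calc _ ≤ ∫⁻ t : Set.Ico (0 : ℝ) 1, ENNReal.ofReal (N * (2 ^ a * ‖1 - z‖ ^ (-a))) *
          ENNReal.ofReal (max (1 - ‖z‖) (1 - (t : ℝ)) ^ (-(γ + 1 - a))) ∂μ := by
          apply lintegral_mono
          intro t
          beta_reduce
          rw [← ENNReal.ofReal_mul (by positivity)]
          exact ENNReal.ofReal_le_ofReal (hpt t)
      _ ≤ ENNReal.ofReal (N * (2 ^ a * ‖1 - z‖ ^ (-a))) *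
          ENNReal.ofReal (K * (1 - ‖z‖) ^ (1 - (γ + 1 - a))) := by
          rw [lintegral_const_mul' _ _ ENNReal.ofReal_ne_top]
          gcongr
          exact hKb _ hz0
      _ = _ := by
          rw [← ENNReal.ofReal_mul (by positivity)]
          congr 1
          have : 1 - (γ + 1 - a) = a - γ := by ring
          rw [this]
          ring
  exact (norm_integral_le_lintegral_norm _).trans
    (ENNReal.toReal_le_of_le_ofReal (by positivity) hlin)

theorem isBoundedOnAnalyticTentSpace_cesaroLike {ζ p α : ℝ} (hζ : 1 / 2 < ζ) (hp : 1 ≤ p)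
    (hα : -2 < α) {μ : Measure (Set.Ico (0 : ℝ) 1)} [IsFiniteMeasure μ]
    (hμ : IsCarlesonMeasure μ) : IsBoundedOnAnalyticTentSpace ζ p α (cesaroLike μ) := by
  have hp0 : 0 < p := by linarith
  have hγ : 0 < (α + 2) / p := div_pos (by linarith) hp0
  -- a < γ serves the integral against μ, and ap < 1 the box integrals.
  obtain ⟨a, ha, haγ⟩ := exists_between (lt_min hγ (one_div_pos.2 hp0))
  rw [lt_min_iff, lt_div_iff₀ (b := 1) hp0] at haγ
  have ha1 : a ≤ 1 := by nlinarith
  obtain ⟨K₁, hK₁, h₁⟩ := exists_norm_le_of_mem_analyticTentSpace α hζ hp hα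
  obtain ⟨K₂, hK₂, h₂⟩ := hμ.exists_norm_cesaroLike_le ha ha1 haγ.1
  obtain ⟨K₃, hK₃, h₃⟩ := exists_boxAverage_le_of_norm_le α hp ha haγ.2
  have hbound : ∀ f ∈ analyticTentSpace ζ p α, tentNorm ζ p α (cesaroLike μ f) ≤
      ((K₃ ^ (1 / p) * (K₂ * K₁)).toNNReal : ℝ≥0∞) * tentNorm ζ p α f := by
    intro f hf
    set N := (tentNorm ζ p α f).toReal with hN
    have hN0 : 0 ≤ N := ENNReal.toReal_nonneg
    have hb := h₃ (cesaroLike μ f) (K₂ * (K₁ * N)) (by positivity)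
      (h₂ f (K₁ * N) (by positivity) (h₁ f hf))
    refine (tentNorm_le_of_boxAverage_le hp hb).trans_eq ?_
    rw [ENNReal.ofReal_rpow_of_nonneg (by positivity) (by positivity),
      Real.mul_rpow hK₃.le (by positivity), ← Real.rpow_mul (by positivity),
      mul_one_div_cancel hp0.ne', Real.rpow_one]
    rw [← ENNReal.ofReal_toReal hf.1.2.ne, ← hN]
    change _ = ENNReal.ofReal _ * _
    rw [← ENNReal.ofReal_mul (by positivity)]
    congr 1
    ring
  refine ⟨(K₃ ^ (1 / p) * (K₂ * K₁)).toNNReal, fun f hf => ⟨?_, hbound f hf⟩⟩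
  exact mem_analyticTentSpace_of_differentiableOn (differentiableOn_cesaroLike μ hf.2)
    ((hbound f hf).trans_lt (ENNReal.mul_lt_top ENNReal.coe_lt_top hf.1.2))

/-! ### Necessity: the test function (1-z)^(-γ). -/

/-- Since 1-|z| ≤ |1-z| and a < γ, the factor |1-z|^(a-γ) is at most (1-|z|)^(a-γ), so the same
majorant applies. -/
theorem one_sub_cpow_mem_analyticTentSpace (ζ : ℝ) {p α : ℝ} (hp : 1 ≤ p) (hα : -2 < α) :
    (fun z : ℂ => (1 - z) ^ ((-((α + 2) / p) : ℝ) : ℂ)) ∈ analyticTentSpace ζ p α := by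
  have hp0 : 0 < p := by linarith
  set γ := (α + 2) / p with hγd
  have hγ : 0 < γ := div_pos (by linarith) hp0
  obtain ⟨a, ha, haγ⟩ := exists_between (lt_min hγ (one_div_pos.2 hp0))
  rw [lt_min_iff, lt_div_iff₀ (b := 1) hp0] at haγ
  obtain ⟨K, hK, h⟩ := exists_boxAverage_le_of_norm_le α hp ha haγ.2
  apply mem_analyticTentSpace_of_differentiableOn
  · intro z hz
    have hz1 : ‖z‖ < 1 := by simpa [unitDisc] using hz
    have hs : 1 - z ∈ Complex.slitPlane := by
      left
      have := (Complex.re_le_norm z)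
      simp only [Complex.sub_re, Complex.one_re]
      linarith
    have hd : DifferentiableAt ℂ (fun z : ℂ => 1 - z) z := by fun_prop
    exact (hd.cpow_const hs).differentiableWithinAt
  · have hb := h (fun z : ℂ => (1 - z) ^ ((-γ : ℝ) : ℂ)) 1 zero_le_one (by
      intro z hz
      have hz1 : ‖z‖ < 1 := by simpa [unitDisc] using hz
      have h1z : 0 < ‖1 - z‖ := norm_pos_iff.2 (one_sub_ne_zero_of_mem_unitDisc hz)
      have hle : 1 - ‖z‖ ≤ ‖1 - z‖ := by simpa using norm_sub_norm_le (1 : ℂ) z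
      rw [Complex.norm_cpow_real, one_mul]
      calc ‖1 - z‖ ^ (-γ) = ‖1 - z‖ ^ (a - γ) * ‖1 - z‖ ^ (-a) := by
            rw [← Real.rpow_add h1z]; congr 1; ring
        _ ≤ _ := mul_le_mul_of_nonneg_right
            (Real.rpow_le_rpow_of_nonpos (by linarith) hle (by linarith [haγ.1]))
            (by positivity))
    exact (tentNorm_le_of_boxAverage_le hp hb).trans_lt
      (ENNReal.rpow_lt_top_of_nonneg (by positivity) ENNReal.ofReal_ne_top)

/-- At a real point the integrand is positive, so nothing cancels; restrict to t ≥ x, where 1-tx ≤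
1-x² ≤ 2(1-x). -/
theorem measureReal_Ici_mul_le_norm_cesaroLike (μ : Measure (Set.Ico (0 : ℝ) 1)) [IsFiniteMeasure μ]
    {γ : ℝ} (hγ : 0 < γ) (x : Set.Ico (0 : ℝ) 1) :
    μ.real (Set.Ici x) * (2 * (1 - (x : ℝ))) ^ (-(γ + 1)) ≤
      ‖cesaroLike μ (fun z : ℂ => (1 - z) ^ ((-γ : ℝ) : ℂ)) ((x : ℝ) : ℂ)‖ := by
  have hx0 := x.2.1
  have hx1 := x.2.2
  have hpos : ∀ t : Set.Ico (0 : ℝ) 1, 1 - (x : ℝ) ≤ 1 - (t : ℝ) * x := fun t => by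
    nlinarith [t.2.1, t.2.2]
  have hval : cesaroLike μ (fun z : ℂ => (1 - z) ^ ((-γ : ℝ) : ℂ)) ((x : ℝ) : ℂ)
      = ((∫ t : Set.Ico (0 : ℝ) 1, (1 - (t : ℝ) * x) ^ (-(γ + 1)) ∂μ : ℝ) : ℂ) := by
    rw [cesaroLike, ← integral_complex_ofReal]
    congr 1
    ext t
    have h0 : 0 < 1 - (t : ℝ) * x := by linarith [hpos t]
    have e1 : (1 - ((t : ℝ) : ℂ) * ((x : ℝ) : ℂ)) = ((1 - (t : ℝ) * x : ℝ) : ℂ) := by push_cast; ring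
    rw [e1, ← Complex.ofReal_cpow h0.le, ← Complex.ofReal_div, neg_add, ← sub_eq_add_neg,
      Real.rpow_sub_one h0.ne']
  have hint : Integrable (fun t : Set.Ico (0 : ℝ) 1 => (1 - (t : ℝ) * x) ^ (-(γ + 1))) μ := by
    apply Integrable.of_bound (C := (1 - (x : ℝ)) ^ (-(γ + 1)))
    · apply Continuous.aestronglyMeasurable
      apply Continuous.rpow_const (by fun_prop)
      intro t
      left
      linarith [hpos t]
    · refine .of_forall fun t => ?_
      rw [Real.norm_of_nonneg (Real.rpow_nonneg (by linarith [hpos t]) _)]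
      exact Real.rpow_le_rpow_of_nonpos (by linarith) (hpos t) (by linarith)
  rw [hval, Complex.norm_real, ← smul_eq_mul, ← integral_indicator_const _ measurableSet_Ici]
  refine le_trans ?_ (le_abs_self _)
  apply integral_mono ((integrable_const _).indicator measurableSet_Ici) hint
  intro t
  have hp := hpos t
  by_cases ht : t ∈ Set.Ici x
  · have ht' : (x : ℝ) ≤ t := ht
    simp only [Set.indicator_of_mem ht]
    exact Real.rpow_le_rpow_of_nonpos (by linarith) (by nlinarith) (by linarith)
  · simp only [Set.indicator_of_notMem ht]
    exact Real.rpow_nonneg (by linarith) _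

theorem isCarlesonMeasure_of_isBounded {ζ p α : ℝ} (hζ : 1 / 2 < ζ) (hp : 1 ≤ p)
    (hα : -2 < α) {μ : Measure (Set.Ico (0 : ℝ) 1)} [IsFiniteMeasure μ]
    (h : IsBoundedOnAnalyticTentSpace ζ p α (cesaroLike μ)) : IsCarlesonMeasure μ := by
  have hγ : 0 < (α + 2) / p := div_pos (by linarith) (by linarith)
  obtain ⟨C, hC⟩ := h
  have hmem := (hC _ (one_sub_cpow_mem_analyticTentSpace ζ hp hα)).1
  obtain ⟨K, hK, hgrowth⟩ := exists_norm_le_of_mem_analyticTentSpace α hζ hp hα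
  have hg := hgrowth _ hmem
  set γ := (α + 2) / p with hγd
  set N := (tentNorm ζ p α (cesaroLike μ fun z : ℂ => (1 - z) ^ ((-γ : ℝ) : ℂ))).toReal with hN
  have hN0 : 0 ≤ N := ENNReal.toReal_nonneg
  -- The summand 1 only makes the constant strictly positive, as N is merely known to be
  -- nonnegative.
  refine ⟨2 ^ (γ + 1) * (K * N) + 1, by positivity, fun x => ?_⟩
  have hx0 := x.2.1
  have hx1 : 0 < 1 - (x : ℝ) := by linarith [x.2.2]
  have hxn : ‖((x : ℝ) : ℂ)‖ = x := by rw [Complex.norm_real, Real.norm_of_nonneg hx0]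
  have hup := hg ((x : ℝ) : ℂ) (by simpa [unitDisc, abs_of_nonneg hx0] using x.2.2)
  rw [hxn] at hup
  have hlow := (measureReal_Ici_mul_le_norm_cesaroLike μ hγ x).trans hup
  have e1 : (2 * (1 - (x : ℝ))) ^ (-(γ + 1))
      = (2 ^ (γ + 1))⁻¹ * ((1 - (x : ℝ)) ^ (-γ) * (1 - (x : ℝ))⁻¹) := by
    rw [Real.mul_rpow (by norm_num) hx1.le, Real.rpow_neg (by norm_num), ← Real.rpow_neg_one (1 - _),
      ← Real.rpow_add hx1]
    congr 2
    ring
  have hpow : 0 < (1 - (x : ℝ)) ^ (-γ) := by positivity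
  have h2 : (0 : ℝ) < 2 ^ (γ + 1) := by positivity
  have hle : μ.real (Set.Ici x) ≤ 2 ^ (γ + 1) * (K * N) * (1 - (x : ℝ)) := by
    rw [e1] at hlow
    have e2 : μ.real (Set.Ici x) * ((2 ^ (γ + 1))⁻¹ * ((1 - (x : ℝ)) ^ (-γ) * (1 - (x : ℝ))⁻¹))
        = (μ.real (Set.Ici x) / (2 ^ (γ + 1) * (1 - (x : ℝ)))) * (1 - (x : ℝ)) ^ (-γ) := by
      field_simp
    rw [e2] at hlow
    have := le_of_mul_le_mul_right hlow hpow
    rw [div_le_iff₀ (by positivity)] at this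
    linarith
  rw [← ENNReal.ofReal_toReal (measure_ne_top μ (Set.Ici x))]
  apply ENNReal.ofReal_le_ofReal
  rw [← measureReal_def]
  linarith

theorem mainTheorem1 (ζ : ℝ) (hζ : 1 / 2 < ζ) (p : ℝ) (hp : 1 ≤ p) (α : ℝ) (hα : -2 < α)
    (μ : Measure (Set.Ico (0 : ℝ) 1)) [IsFiniteMeasure μ] :
    IsBoundedOnAnalyticTentSpace ζ p α (cesaroLike μ) ↔ IsCarlesonMeasure μ :=
  ⟨isCarlesonMeasure_of_isBounded hζ hp hα, isBoundedOnAnalyticTentSpace_cesaroLike hζ hp hα⟩
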